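/- Let $c\in\mathbb{R}$, $c\neq 0$, be fixed, and let $\mathcal{H},\mathcal{H}_1,\mathcal{H}_2$ be real separable Hilbert spaces. Write $\mathrm{Sym}(\mathcal{H})$ for the bounded self-adjoint operators on $\mathcal{H}$, $\mathrm{Sym}^+(\mathcal{H})$ for those that are positive, i.e. $\langle Ax,x\rangle\ge 0$ for all $x$, $\mathrm{Tr}(\mathcal{H})$ for the trace class operators, with norm $\|A\|_{\mathrm{tr}}=\sum_k\langle e_k,(A^*A)^{1/2}e_k\rangle$ and trace $\mathrm{tr}(A)=\sum_k\langle e_k,Ae_k\rangle$, and $\mathrm{HS}(\mathcal{H}_1,\mathcal{H}_2)$ for the Hilbert–Schmidt operators from $\mathcal{H}_1$ to $\mathcal{H}_2$, with norm $\|A\|_{\mathrm{HS}}=\left(\sum_k\|Ae_k\|^2\right)^{1/2}$, where $\{e_k\}$ is any orthonormal basis of the domain; $\mathrm{HS}(\mathcal{H})=\mathrm{HS}(\mathcal{H},\mathcal{H})$. For a real separable Hilbert space $\mathcal{K}$ and $A\in\mathrm{Sym}^+(\mathcal{K})\cap\mathrm{Tr}(\mathcal{K})$ define $$G(A)=\mathrm{tr}[M(A)]-\log\det\left(I+\tfrac12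 M(A)\right),\qquad M(A)=-I+(I+c^2A)^{1/2},$$ where $\det$ is the Fredholm determinant. This is well defined: $M(A)\in\mathrm{Sym}^+(\mathcal{K})\cap\mathrm{Tr}(\mathcal{K})$, and $\det\left(I+\frac12M(A)\right)$ exists and is positive. 1. For all $A,B\in\mathrm{Sym}^+(\mathcal{H})\cap\mathrm{Tr}(\mathcal{H})$, $$|G(A)-G(B)|\le\frac{3c^2}{4}\|A-B\|_{\mathrm{tr}}.$$ 2. For all $A,B\in\mathrm{Sym}(\mathcal{H})\cap\mathrm{HS}(\mathcal{H})$ one has $A^2,B^2\in\mathrm{Sym}^+(\mathcal{H})\cap\mathrm{Tr}(\mathcal{H})$ and $$|G(A^2)-G(B^2)|\le\frac{3c^2}{4}\left[\|A\|_{\mathrm{HS}}+\|B\|_{\mathrm{HS}}\right]\|A-B\|_{\mathrm{HS}}.$$ 3. For all $A,B\in\mathrm{HS}(\mathcal{H}_1,\mathcal{H}_2)$ one has $A^*A,B^*B\in\mathrm{Sym}^+(\mathcal{H}_1)\cap\mathrm{Tr}(\mathcal{H}_1)$ and $$|G(A^*A)-G(B^*B)|\le\frac{3c^2}{4}\left[\|A\|_{\mathrm{HS}}+\|B\|_{\mathrm{HS}}\right]\|A-B\|_{\mathrm{HS}}.$$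 -/

import Mathlib

open Filter Topology
open scoped ENNReal

namespace HilbertOperator

section SquareRoot

variable {H : Type*} [NormedAddCommGroup H] [InnerProductSpace ℝ H]

/-- Polynomials converging on `[-1, 1]` to `1 - (1 - x)^{1/2}`. -/
noncomputable def sqrtPoly : ℕ → Polynomial ℝ
  | 0 => 0
  | n + 1 => Polynomial.C (1 / 2) * (Polynomial.X + sqrtPoly n * sqrtPoly n)

theorem coeff_mul_nonneg {p q : Polynomial ℝ} (hp : ∀ k, 0 ≤ p.coeff k)
    (hq : ∀ k, 0 ≤ q.coeff k) (k : ℕ) : 0 ≤ (p * q).coeff k := by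
  rw [Polynomial.coeff_mul]
  exact Finset.sum_nonneg fun x _ => mul_nonneg (hp _) (hq _)

theorem coeff_half_mul_nonneg {p : Polynomial ℝ} (hp : ∀ k, 0 ≤ p.coeff k) (k : ℕ) :
    0 ≤ (Polynomial.C (1 / 2 : ℝ) * p).coeff k := by
  rw [Polynomial.coeff_C_mul]
  exact mul_nonneg (by norm_num) (hp k)

theorem sqrtPoly_coeff_nonneg (n k : ℕ) : 0 ≤ (sqrtPoly n).coeff k := by
  induction n generalizing k with
  | zero => simp [sqrtPoly]
  | succ n ih =>
    refine coeff_half_mul_nonneg (fun j => ?_) k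
    rw [Polynomial.coeff_add]
    refine add_nonneg ?_ (coeff_mul_nonneg ih ih j)
    rw [Polynomial.coeff_X]
    split_ifs <;> norm_num

theorem sqrtPoly_succ_sub_coeff_nonneg (n k : ℕ) :
    0 ≤ (sqrtPoly (n + 1) - sqrtPoly n).coeff k := by
  induction n generalizing k with
  | zero => simpa [sqrtPoly] using sqrtPoly_coeff_nonneg 1 k
  | succ n ih =>
    have h : sqrtPoly (n + 2) - sqrtPoly (n + 1) = Polynomial.C (1 / 2) *
        ((sqrtPoly (n + 1) + sqrtPoly n) * (sqrtPoly (n + 1) - sqrtPoly n)) := by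
      change Polynomial.C (1 / 2) * (Polynomial.X + sqrtPoly (n + 1) * sqrtPoly (n + 1)) -
        Polynomial.C (1 / 2) * (Polynomial.X + sqrtPoly n * sqrtPoly n) = _
      ring
    rw [h]
    refine coeff_half_mul_nonneg (coeff_mul_nonneg (fun j => ?_) ih) k
    rw [Polynomial.coeff_add]
    exact add_nonneg (sqrtPoly_coeff_nonneg _ _) (sqrtPoly_coeff_nonneg _ _)

theorem sqrtPoly_sub_coeff_nonneg {m n : ℕ} (hmn : m ≤ n) (k : ℕ) :
    0 ≤ (sqrtPoly n - sqrtPoly m).coeff k := by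
  induction n, hmn using Nat.le_induction with
  | base => simp
  | succ n _ ih =>
    have := sqrtPoly_succ_sub_coeff_nonneg n k
    simp only [Polynomial.coeff_sub] at *
    linarith

theorem eval_one_nonneg {p : Polynomial ℝ} (hp : ∀ k, 0 ≤ p.coeff k) : 0 ≤ p.eval 1 := by
  rw [Polynomial.eval_eq_sum_range]
  exact Finset.sum_nonneg fun k _ => by simpa using hp k

theorem sqrtPoly_eval_one_le (n : ℕ) : (sqrtPoly n).eval 1 ≤ 1 := by
  induction n with
  | zero => simp [sqrtPoly]
  | succ n ih =>
    have h0 := eval_one_nonneg (sqrtPoly_coeff_nonneg n)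
    simp only [sqrtPoly, Polynomial.eval_mul, Polynomial.eval_C, Polynomial.eval_add,
      Polynomial.eval_X]
    nlinarith

theorem norm_aeval_le {Y : H →L[ℝ] H} (hY : ‖Y‖ ≤ 1) {p : Polynomial ℝ}
    (hp : ∀ k, 0 ≤ p.coeff k) : ‖Polynomial.aeval Y p‖ ≤ p.eval 1 := by
  rw [Polynomial.aeval_eq_sum_range, Polynomial.eval_eq_sum_range]
  refine norm_sum_le_of_le _ fun k _ => ?_
  rw [norm_smul, Real.norm_of_nonneg (hp k)]
  have h1 : ‖Y ^ k‖ ≤ 1 := by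
    clear * - hY
    induction k with
    | zero =>
      rw [pow_zero]
      exact ContinuousLinearMap.norm_id_le
    | succ k ih =>
      rw [pow_succ]
      exact (norm_mul_le _ _).trans (mul_le_one₀ ih (norm_nonneg _) hY)
  simpa using mul_le_mul_of_nonneg_left h1 (hp k)

variable [CompleteSpace H]

/-- If `Y` is self-adjoint with norm at most `1`, then `1 - Y` has a positive square root which
commutes with every operator commuting with `Y`. -/
theorem exists_sqrt_one_sub {Y : H →L[ℝ] H} (hsa : IsSelfAdjoint Y) (hY : ‖Y‖ ≤ 1) :
    ∃ S : H →L[ℝ] H, S.IsPositive ∧ S * S = 1 - Y ∧ ∀ B, Commute B Y → Commute B S := by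
  have hmono : Monotone fun n => (sqrtPoly n).eval 1 := by
    refine monotone_nat_of_le_succ fun n => ?_
    have := eval_one_nonneg (sqrtPoly_succ_sub_coeff_nonneg n)
    simp only [Polynomial.eval_sub] at this
    linarith
  have hbdd : BddAbove (Set.range fun n => (sqrtPoly n).eval 1) :=
    ⟨1, by rintro _ ⟨n, rfl⟩; exact sqrtPoly_eval_one_le n⟩
  have hc := (tendsto_atTop_ciSup hmono hbdd).cauchySeq
  have hcau : CauchySeq fun n => Polynomial.aeval Y (sqrtPoly n) := by
    rw [Metric.cauchySeq_iff'] at hc ⊢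
    intro ε hε
    obtain ⟨N, hN⟩ := hc ε hε
    refine ⟨N, fun n hn => lt_of_le_of_lt ?_ (hN n hn)⟩
    rw [dist_eq_norm, ← map_sub, Real.dist_eq, ← Polynomial.eval_sub]
    exact (norm_aeval_le hY (sqrtPoly_sub_coeff_nonneg hn)).trans (le_abs_self _)
  obtain ⟨Z, hZ⟩ := cauchySeq_tendsto_of_complete hcau
  have hZn : ‖Z‖ ≤ 1 := by
    refine le_of_tendsto hZ.norm (Eventually.of_forall fun n => ?_)
    exact (norm_aeval_le hY (sqrtPoly_coeff_nonneg n)).trans (sqrtPoly_eval_one_le n)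
  have hZeq : Z = (1 / 2 : ℝ) • (Y + Z * Z) := by
    refine tendsto_nhds_unique (hZ.comp (tendsto_add_atTop_nat 1)) ?_
    have h2 : Tendsto (fun n => (1 / 2 : ℝ) • (Y + Polynomial.aeval Y (sqrtPoly n) *
        Polynomial.aeval Y (sqrtPoly n))) atTop (𝓝 ((1 / 2 : ℝ) • (Y + Z * Z))) :=
      ((hZ.mul hZ).const_add Y).const_smul _
    refine h2.congr fun n => ?_
    simp only [Function.comp, sqrtPoly, map_mul, map_add, Polynomial.aeval_X, Polynomial.aeval_C,
      Algebra.algebraMap_eq_smul_one, smul_mul_assoc, one_mul]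
  have hZsa : IsSelfAdjoint Z := by
    refine tendsto_nhds_unique ((continuous_star.tendsto Z).comp hZ) (hZ.congr fun n => ?_)
    refine Eq.symm (?_ : IsSelfAdjoint (Polynomial.aeval Y (sqrtPoly n)))
    induction n with
    | zero => simp [sqrtPoly]
    | succ n ih =>
      have hcomm : Commute (Polynomial.aeval Y (sqrtPoly n)) (Polynomial.aeval Y (sqrtPoly n)) :=
        Commute.refl _
      simp only [sqrtPoly, map_mul, map_add, Polynomial.aeval_X, Polynomial.aeval_C,
        Algebra.algebraMap_eq_smul_one, smul_mul_assoc, one_mul]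
      exact IsSelfAdjoint.smul (by simp [IsSelfAdjoint])
        (hsa.add ((IsSelfAdjoint.commute_iff ih ih).mp hcomm))
  refine ⟨1 - Z, ?_, ?_, ?_⟩
  · rw [ContinuousLinearMap.isPositive_iff']
    refine ⟨(IsSelfAdjoint.one _).sub hZsa, fun x => ?_⟩
    have h1 : inner ℝ (Z x) x ≤ ‖Z x‖ * ‖x‖ := real_inner_le_norm _ _
    have h2 : ‖Z x‖ ≤ 1 * ‖x‖ := Z.le_of_opNorm_le hZn x
    simp only [sub_apply, one_apply_eq_self, inner_sub_left,
      real_inner_self_eq_norm_sq]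
    nlinarith [norm_nonneg x]
  · have h3 : (2 : ℝ) • Z = Y + Z * Z := by
      conv_lhs => rw [hZeq]
      rw [smul_smul]
      norm_num
    have h4 : Z + Z = Y + Z * Z := by rw [← h3, two_smul]
    have h5 : (1 - Z) * (1 - Z) = 1 - (Z + Z) + Z * Z := by noncomm_ring
    rw [h5, h4]
    abel
  · intro B hB
    refine (Commute.one_right B).sub_right ?_
    refine tendsto_nhds_unique (hZ.const_mul B) ((hZ.mul_const B).congr fun n => ?_)
    induction n with
    | zero => simp [sqrtPoly]
    | succ n ih =>
      have ih' : Commute B (Polynomial.aeval Y (sqrtPoly n)) := ih.symm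
      simp only [sqrtPoly, map_mul, map_add, Polynomial.aeval_X, Polynomial.aeval_C,
        Algebra.algebraMap_eq_smul_one, smul_mul_assoc, one_mul]
      rw [← smul_mul_assoc]
      exact ((hB.add_right (ih'.mul_right ih')).smul_right (1 / 2 : ℝ)).eq.symm

/-- Every positive operator has a positive square root commuting with its commutant. -/
theorem exists_sqrt {A : H →L[ℝ] H} (hA : A.IsPositive) :
    ∃ S : H →L[ℝ] H, S.IsPositive ∧ S * S = A ∧ ∀ B, Commute B A → Commute B S := by
  set r : ℝ := ‖A‖ + 1 with hr
  have hr0 : 0 < r := by positivity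
  have hsa := hA.isSelfAdjoint
  have hY : ‖1 - r⁻¹ • A‖ ≤ 1 := by
    refine ContinuousLinearMap.opNorm_le_bound _ zero_le_one fun x => ?_
    rw [one_mul]
    set T : H →L[ℝ] H := r⁻¹ • A with hT
    have hTp : T.IsPositive := hA.smul_of_nonneg (by positivity)
    have hTn : ‖T‖ ≤ 1 := by
      rw [hT, norm_smul, Real.norm_of_nonneg (by positivity), inv_mul_le_iff₀ hr0]
      linarith
    have h1 := hTp.inner_nonneg_left (x - T x)
    have h2 : inner ℝ (T (T x)) (T x) ≤ ‖T x‖ ^ 2 := by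
      have h3 : ‖T (T x)‖ ≤ 1 * ‖T x‖ := T.le_of_opNorm_le hTn _
      have h4 := real_inner_le_norm (T (T x)) (T x)
      nlinarith [norm_nonneg (T x)]
    have h5 : inner ℝ (T (T x)) x = ‖T x‖ ^ 2 := by
      rw [hTp.inner_left_eq_inner_right, real_inner_self_eq_norm_sq]
    have h6 : inner ℝ (T x) (T x) = ‖T x‖ ^ 2 := real_inner_self_eq_norm_sq _
    simp only [map_sub, inner_sub_left, inner_sub_right, h5, h6] at h1
    have h7 : ‖x - T x‖ ^ 2 = ‖x‖ ^ 2 - 2 * inner ℝ (T x) x + ‖T x‖ ^ 2 := by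
      rw [norm_sub_sq_real, real_inner_comm]
    have h8 : ‖x - T x‖ ^ 2 ≤ ‖x‖ ^ 2 := by
      have := sq_nonneg ‖T x‖
      nlinarith
    exact le_of_sq_le_sq h8 (norm_nonneg _)
  obtain ⟨S, hS, hSS, hcomm⟩ := exists_sqrt_one_sub
    ((IsSelfAdjoint.one _).sub (IsSelfAdjoint.smul (by simp [IsSelfAdjoint]) hsa)) hY
  refine ⟨Real.sqrt r • S, hS.smul_of_nonneg (Real.sqrt_nonneg _), ?_, fun B hB => ?_⟩
  · rw [smul_mul_smul_comm, Real.mul_self_sqrt hr0.le, hSS, sub_sub_cancel, smul_smul,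
      mul_inv_cancel₀ hr0.ne', one_smul]
  · exact (hcomm B ((Commute.one_right B).sub_right (hB.smul_right _))).smul_right _

/-- The positive square root is unique. -/
theorem sqrt_unique {B C : H →L[ℝ] H} (hB : B.IsPositive) (hC : C.IsPositive)
    (h : B * B = C * C) : B = C := by
  have key : ∀ {B S : H →L[ℝ] H}, B.IsPositive → S.IsPositive → Commute B S → B * B = S * S →
      B = S := by
    intro B S hB hS hc h
    have hD : IsSelfAdjoint (B - S) := hB.isSelfAdjoint.sub hS.isSelfAdjoint
    have h0 : (B + S) * (B - S) = 0 := by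
      have : (B + S) * (B - S) = B * B - S * S + (S * B - B * S) := by noncomm_ring
      rw [this, h, hc.eq]
      simp
    refine sub_eq_zero.mp (ContinuousLinearMap.ext fun x => ?_)
    set D := B - S with hDdef
    have h1 : inner ℝ ((B + S) (D x)) (D x) = 0 := by
      have : (B + S) (D x) = ((B + S) * D) x := rfl
      rw [this, h0]
      simp
    rw [add_apply, inner_add_left] at h1
    have hb := hB.inner_nonneg_left (D x)
    have hs := hS.inner_nonneg_left (D x)
    have zero_of : ∀ {P : H →L[ℝ] H}, P.IsPositive → ∀ y, inner ℝ (P y) y = 0 → P y = 0 := by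
      intro P hP y hy
      obtain ⟨R, hR, hRR, -⟩ := exists_sqrt hP
      have h2 : P y = R (R y) := by rw [← hRR]; rfl
      rw [h2, hR.inner_left_eq_inner_right, real_inner_self_eq_norm_sq] at hy
      have : R y = 0 := by simpa using hy
      rw [h2, this, map_zero]
    have hb0 := zero_of hB _ (by linarith : inner ℝ (B (D x)) (D x) = 0)
    have hs0 := zero_of hS _ (by linarith : inner ℝ (S (D x)) (D x) = 0)
    have hDD : D (D x) = 0 := by
      rw [hDdef, sub_apply, ← hDdef, hb0, hs0, sub_zero]
    have h3 : inner ℝ (D x) (D x) = 0 := by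
      have := hD.isSymmetric (D x) x
      simp only [ContinuousLinearMap.coe_coe, hDD, inner_zero_left] at this
      exact this.symm
    simpa using h3
  have hp : (B * B).IsPositive := by
    have := ContinuousLinearMap.isPositive_adjoint_comp_self B
    rwa [hB.isSelfAdjoint.adjoint_eq] at this
  obtain ⟨S, hS, hSS, hcomm⟩ := exists_sqrt hp
  have h1 := key hB hS (hcomm B ((Commute.refl B).mul_right (Commute.refl B))) hSS.symm
  have h2 := key hC hS (hcomm C (h ▸ (Commute.refl C).mul_right (Commute.refl C)))
    (h.symm.trans hSS.symm)
  rw [h1, h2]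

open Classical in
/-- `A^{1/2}`: for positive `A`, the unique positive `S` with `S * S = A`. -/
noncomputable def posSqrt (A : H →L[ℝ] H) : H →L[ℝ] H :=
  if h : ∃ S : H →L[ℝ] H, S.IsPositive ∧ S * S = A then h.choose else 0

theorem posSqrt_spec {A : H →L[ℝ] H} (hA : A.IsPositive) :
    (posSqrt A).IsPositive ∧ posSqrt A * posSqrt A = A := by
  obtain ⟨S, hS, hSS, -⟩ := exists_sqrt hA
  have h : ∃ S : H →L[ℝ] H, S.IsPositive ∧ S * S = A := ⟨S, hS, hSS⟩
  rw [posSqrt, dif_pos h]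
  exact h.choose_spec

/-- `|A| = (A* A)^{1/2}`. -/
noncomputable def absOp (A : H →L[ℝ] H) : H →L[ℝ] H :=
  posSqrt (A.adjoint ∘L A)

theorem absOp_isPositive (A : H →L[ℝ] H) : (absOp A).IsPositive :=
  (posSqrt_spec (ContinuousLinearMap.isPositive_adjoint_comp_self A)).1

end SquareRoot

section Classes

variable {H K : Type*} [NormedAddCommGroup H] [InnerProductSpace ℝ H] [CompleteSpace H]
  [NormedAddCommGroup K] [InnerProductSpace ℝ K] [CompleteSpace K]

variable (H) in
/-- Index set of a fixed orthonormal (Hilbert) basis of `H`. -/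
noncomputable def basisIndex : Set H := (exists_hilbertBasis ℝ H).choose

variable (H) in
/-- A fixed orthonormal (Hilbert) basis of `H`. -/
noncomputable def stdBasis : HilbertBasis (basisIndex H) ℝ H :=
  (exists_hilbertBasis ℝ H).choose_spec.choose

/-- Hilbert-Schmidt operators: `∑ ‖A eₖ‖² < ∞`. -/
def IsHilbertSchmidt (A : H →L[ℝ] K) : Prop :=
  Summable fun i => ‖A (stdBasis H i)‖ ^ 2

/-- The Hilbert-Schmidt norm `(∑ ‖A eₖ‖²)^{1/2}`. -/
noncomputable def hsNorm (A : H →L[ℝ] K) : ℝ :=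
  Real.sqrt (∑' i, ‖A (stdBasis H i)‖ ^ 2)

/-- Trace class operators: `∑ ⟨eₖ, |A| eₖ⟩ < ∞`. -/
def IsTraceClass (A : H →L[ℝ] H) : Prop :=
  Summable fun i => inner ℝ (stdBasis H i) (absOp A (stdBasis H i))

/-- The trace norm `∑ ⟨eₖ, |A| eₖ⟩`. -/
noncomputable def traceNorm (A : H →L[ℝ] H) : ℝ :=
  ∑' i, inner ℝ (stdBasis H i) (absOp A (stdBasis H i))

/-- The trace `∑ ⟨eₖ, A eₖ⟩` of a trace class operator. -/
noncomputable def trace (A : H →L[ℝ] H) : ℝ :=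
  ∑' i, inner ℝ (stdBasis H i) (A (stdBasis H i))

/- The Hilbert-Schmidt and trace class notions, and the trace of a positive operator, do not depend
on the basis. -/

theorem tsum_inner_sq {ι : Type*} (b : HilbertBasis ι ℝ H) (x : H) :
    ∑' i, ENNReal.ofReal (inner ℝ (b i) x ^ 2) = ENNReal.ofReal (‖x‖ ^ 2) := by
  have h := b.hasSum_inner_mul_inner x x
  simp only [real_inner_self_eq_norm_sq, real_inner_comm x, ← pow_two] at h
  rw [← h.tsum_eq, ENNReal.ofReal_tsum_of_nonneg (fun i => sq_nonneg _) h.summable]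
  simp only [real_inner_comm x]

theorem tsum_norm_sq_adjoint {ι κ : Type*} (b : HilbertBasis ι ℝ H) (c : HilbertBasis κ ℝ K)
    (A : H →L[ℝ] K) : ∑' i, ENNReal.ofReal (‖A (b i)‖ ^ 2) =
      ∑' j, ENNReal.ofReal (‖A.adjoint (c j)‖ ^ 2) := by
  simp only [← tsum_inner_sq b, ← tsum_inner_sq c]
  rw [ENNReal.tsum_comm]
  refine tsum_congr fun j => tsum_congr fun i => ?_
  rw [ContinuousLinearMap.adjoint_inner_right, real_inner_comm]

theorem tsum_norm_sq_basis {ι : Type*} (b : HilbertBasis ι ℝ H) (A : H →L[ℝ] K) :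
    ∑' i, ENNReal.ofReal (‖A (stdBasis H i)‖ ^ 2) = ∑' i, ENNReal.ofReal (‖A (b i)‖ ^ 2) := by
  rw [tsum_norm_sq_adjoint (stdBasis H) (stdBasis K), tsum_norm_sq_adjoint b (stdBasis K)]

theorem summable_iff_tsum_ne_top {ι : Type*} {f : ι → ℝ} (hf : ∀ i, 0 ≤ f i) :
    Summable f ↔ ∑' i, ENNReal.ofReal (f i) ≠ ∞ := by
  refine ⟨fun h => h.tsum_ofReal_ne_top, fun h => ?_⟩
  have := ENNReal.summable_toReal h
  simpa only [ENNReal.toReal_ofReal (hf _)] using this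

theorem tsum_eq_toReal {ι : Type*} {f : ι → ℝ} (hf : ∀ i, 0 ≤ f i) :
    ∑' i, f i = (∑' i, ENNReal.ofReal (f i)).toReal := by
  rw [ENNReal.tsum_toReal_eq fun i => ENNReal.ofReal_ne_top]
  simp only [ENNReal.toReal_ofReal (hf _)]

theorem isHilbertSchmidt_iff {ι : Type*} (b : HilbertBasis ι ℝ H) (A : H →L[ℝ] K) :
    IsHilbertSchmidt A ↔ Summable fun i => ‖A (b i)‖ ^ 2 := by
  rw [IsHilbertSchmidt, summable_iff_tsum_ne_top fun i => sq_nonneg _,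
    summable_iff_tsum_ne_top fun i => sq_nonneg _, tsum_norm_sq_basis b]

theorem hsNorm_eq {ι : Type*} (b : HilbertBasis ι ℝ H) (A : H →L[ℝ] K) :
    hsNorm A = Real.sqrt (∑' i, ‖A (b i)‖ ^ 2) := by
  rw [hsNorm, tsum_eq_toReal fun i => sq_nonneg _, tsum_norm_sq_basis b,
    ← tsum_eq_toReal fun i => sq_nonneg _]

theorem inner_eq_norm_sqrt {T : H →L[ℝ] H} (hT : T.IsPositive) (x : H) :
    inner ℝ x (T x) = ‖posSqrt T x‖ ^ 2 := by
  obtain ⟨hS, hSS⟩ := posSqrt_spec hT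
  conv_lhs => rw [← hSS]
  rw [mul_apply_eq_comp, ← hS.inner_left_eq_inner_right, real_inner_self_eq_norm_sq]

theorem isTraceClass_iff {ι : Type*} (b : HilbertBasis ι ℝ H) (A : H →L[ℝ] H) :
    IsTraceClass A ↔ Summable fun i => inner ℝ (b i) (absOp A (b i)) := by
  simp only [IsTraceClass, inner_eq_norm_sqrt (absOp_isPositive A)]
  exact isHilbertSchmidt_iff b (posSqrt (absOp A))

theorem traceNorm_eq {ι : Type*} (b : HilbertBasis ι ℝ H) (A : H →L[ℝ] H) :
    traceNorm A = ∑' i, inner ℝ (b i) (absOp A (b i)) := by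
  simp only [traceNorm, inner_eq_norm_sqrt (absOp_isPositive A)]
  rw [tsum_eq_toReal fun i => sq_nonneg _, tsum_norm_sq_basis b,
    ← tsum_eq_toReal fun i => sq_nonneg _]

theorem trace_eq_of_isPositive {ι : Type*} (b : HilbertBasis ι ℝ H) {A : H →L[ℝ] H}
    (hA : A.IsPositive) : trace A = ∑' i, inner ℝ (b i) (A (b i)) := by
  simp only [trace, inner_eq_norm_sqrt hA]
  rw [tsum_eq_toReal fun i => sq_nonneg _, tsum_norm_sq_basis b,
    ← tsum_eq_toReal fun i => sq_nonneg _]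

/-- The determinant of the compression of `I + T` to the finite-dimensional subspace `V` spanned
by `s`, that is, of `I_V + P_V T|_V`. -/
noncomputable def compressionDet (T : H →L[ℝ] H) (s : Finset H) : ℝ :=
  LinearMap.det ((LinearMap.id : Submodule.span ℝ (s : Set H) →ₗ[ℝ] _) +
    ((Submodule.span ℝ (s : Set H)).orthogonalProjectionOnto ∘L T ∘L
      (Submodule.span ℝ (s : Set H)).subtypeL).toLinearMap)

/-- `d` is the Fredholm determinant `det(I + T)`: the limit of the determinants of the compressions
of `I + T` along the directed family of all finite-dimensional subspaces. (For `T` of finite rank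
the net is eventually constant, equal to the determinant of `I + T` on any finite-dimensional
subspace containing the range of `T`; in general `det(I + ·)` is the extension of
that determinant to the trace class by continuity in the trace norm.) -/
def HasFredholmDet (T : H →L[ℝ] H) (d : ℝ) : Prop :=
  Tendsto (compressionDet T) atTop (𝓝 d)

/-- The Fredholm determinant `det(I + T)` of a trace class perturbation of the identity. -/
noncomputable def fredholmDet (T : H →L[ℝ] H) : ℝ :=
  limUnder atTop (compressionDet T)

/-- `M(A) = -I + (I + c² A)^{1/2}`. -/
noncomputable def opM (c : ℝ) (A : H →L[ℝ] H) : H →L[ℝ] H :=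
  -1 + posSqrt (1 + c ^ 2 • A)

/-- `G(A) = tr M(A) - log det(I + M(A)/2)`. -/
noncomputable def opG (c : ℝ) (A : H →L[ℝ] H) : ℝ :=
  trace (opM c A) - Real.log (fredholmDet ((1 / 2 : ℝ) • opM c A))

end Classes

end HilbertOperator

set_option linter.unusedSectionVars false

namespace HilbertOperator

/-! ### Compactness, eigenbases and absolute values -/

section Spectral

universe u

variable {H : Type u} {K : Type*} [NormedAddCommGroup H] [InnerProductSpace ℝ H] [CompleteSpace H]
  [NormedAddCommGroup K] [InnerProductSpace ℝ K] [CompleteSpace K]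

/-! Everything rests on testing operators on an orthonormal eigenbasis of a compact self-adjoint
difference. On such a basis the trace norm of the difference is the sum of the absolute values of
its diagonal entries, so trace norm inequalities reduce to scalar ones.

Put `S = (1 + c²A)^{1/2}` and `R = (1 + c²B)^{1/2}`, so that `M(A) - M(B) = S - R` and `c²(A - B) =
S(S - R) + (S - R)R`. At a unit eigenvector `v` of `S - R` with eigenvalue `d`, the diagonal entry
is `c²⟨v, (A - B)v⟩ = d(⟨v, Sv⟩ + ⟨v, Rv⟩)`. Both inner products on the right are at least `1`,
hence `2|d| ≤ c²⟨v, |A - B|v⟩`. Summing shows that `M` is Lipschitz with constant `c²/2`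
(`traceNorm_opM_sub_le`).

The trace is 1-Lipschitz. For the determinant, `M(A)/2 ≤ M(B)/2 + |M(A) - M(B)|/2`, while on
positive operators `det(I + ·)` is monotone and adding `P` multiplies it by at most `exp(tr P)`
(`log_fredholmDet_le`). Thus the logarithm contributes the factor `1/2`, and `(1 + 1/2) · c²/2 =
3c²/4`. The determinant bounds are proved for matrices and pass to the limit over compressions.

The Hilbert–Schmidt bounds follow from `‖A*A - B*B‖_tr ≤ (‖A‖_HS + ‖B‖_HS)‖A - B‖_HS`
(`traceNorm_adjoint_comp_self_sub_le`). -/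

theorem hasSum_inner_sq {ι : Type*} (b : HilbertBasis ι ℝ H) (x : H) :
    HasSum (fun i => inner ℝ (b i) x ^ 2) (‖x‖ ^ 2) := by
  have h := b.hasSum_inner_mul_inner x x
  simpa only [real_inner_self_eq_norm_sq, real_inner_comm x, ← pow_two] using h

/-- Passing to the adjoint makes this Parseval plus Cauchy–Schwarz: `‖A*y‖² = ∑ ⟨A eᵢ, y⟩² ≤ ∑ ‖A
eᵢ‖² ‖y‖²`. -/
theorem norm_le_hsNorm {A : H →L[ℝ] K} (hA : IsHilbertSchmidt A) : ‖A‖ ≤ hsNorm A := by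
  have h : ‖A.adjoint‖ ≤ hsNorm A := by
    refine ContinuousLinearMap.opNorm_le_bound _ (Real.sqrt_nonneg _) fun y => ?_
    refine le_of_sq_le_sq ?_ (mul_nonneg (Real.sqrt_nonneg _) (norm_nonneg y))
    rw [mul_pow, hsNorm, Real.sq_sqrt (tsum_nonneg fun i => sq_nonneg _), ← tsum_mul_right]
    rw [← (hasSum_inner_sq (stdBasis H) (A.adjoint y)).tsum_eq]
    refine Summable.tsum_le_tsum (fun i => ?_) (hasSum_inner_sq _ _).summable (hA.mul_right _)
    rw [ContinuousLinearMap.adjoint_inner_right, ← mul_pow, ← sq_abs]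
    exact pow_le_pow_left₀ (abs_nonneg _) (abs_real_inner_le_norm _ _) 2
  rwa [LinearIsometryEquiv.norm_map] at h

/-- `A` is a norm limit of its finite rank truncations to spans of finitely many basis vectors: the
error has Hilbert–Schmidt norm squared equal to the tail of `∑ ‖A eᵢ‖²`. -/
theorem IsHilbertSchmidt.isCompactOperator {A : H →L[ℝ] K} (hA : IsHilbertSchmidt A) :
    IsCompactOperator A := by
  classical
  set e := stdBasis H
  let V : Finset (basisIndex H) → Submodule ℝ H := fun s => Submodule.span ℝ (s.image e : Set H)
  have hP : ∀ s, IsCompactOperator ⇑(A ∘L (V s).starProjection) := by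
    intro s
    have : FiniteDimensional ℝ (V s) := FiniteDimensional.span_finset ℝ _
    have : ProperSpace (V s) := FiniteDimensional.proper ℝ (V s)
    have h1 : IsCompactOperator (V s).orthogonalProjectionOnto :=
      isCompactOperator_of_locallyCompactSpace_dom (V s).orthogonalProjectionOnto
    exact h1.clm_comp (A ∘L (V s).subtypeL)
  have hval : ∀ s i, ‖(A - A ∘L (V s).starProjection) (e i)‖ ^ 2 =
      (fun i => ‖A (e i)‖ ^ 2) i - if i ∈ s then ‖A (e i)‖ ^ 2 else 0 := by
    intro s i
    by_cases hi : i ∈ s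
    · have : e i ∈ V s := Submodule.subset_span (Finset.mem_image_of_mem _ hi)
      simp [hi, Submodule.starProjection_eq_self_iff.mpr this]
    · have : e i ∈ (V s)ᗮ := by
        rw [Submodule.mem_orthogonal']
        intro x hx
        induction hx using Submodule.span_induction with
        | mem x hx =>
          obtain ⟨j, hj, rfl⟩ : ∃ j ∈ s, e j = x := by simpa using hx
          exact e.orthonormal.2 (fun h => hi (h ▸ hj))
        | zero => simp
        | add x y _ _ hx hy => rw [inner_add_right, hx, hy, add_zero]
        | smul a x _ hx => rw [inner_smul_right, hx, mul_zero]
      simp [hi, (Submodule.starProjection_apply_eq_zero_iff (K := V s)).mpr this]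
  have hs : ∀ s : Finset (basisIndex H),
      HasSum (fun i => ‖(A - A ∘L (V s).starProjection) (e i)‖ ^ 2)
        ((∑' i, ‖A (e i)‖ ^ 2) - ∑ i ∈ s, ‖A (e i)‖ ^ 2) := by
    intro s
    simp only [hval]
    refine hA.hasSum.sub ?_
    rw [← Finset.sum_congr rfl fun i (hi : i ∈ s) => if_pos (c := i ∈ s) (e := (0 : ℝ)) hi]
    exact hasSum_sum_of_ne_finset_zero fun i hi => if_neg hi
  refine isCompactOperator_of_tendsto (l := atTop) (F := fun s => A ∘L (V s).starProjection)
    ?_ (Eventually.of_forall hP)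
  rw [tendsto_iff_norm_sub_tendsto_zero]
  have hlim : Tendsto (fun s : Finset (basisIndex H) =>
      Real.sqrt ((∑' i, ‖A (e i)‖ ^ 2) - ∑ i ∈ s, ‖A (e i)‖ ^ 2)) atTop (𝓝 0) := by
    have h1 : Tendsto (fun s : Finset (basisIndex H) => ∑ i ∈ s, ‖A (e i)‖ ^ 2) atTop
      (𝓝 (∑' i, ‖A (e i)‖ ^ 2)) := hA.hasSum
    have := ((tendsto_const_nhds (x := ∑' i, ‖A (e i)‖ ^ 2)).sub h1).sqrt
    simpa using this
  refine squeeze_zero (fun s => norm_nonneg _) (fun s => ?_) hlim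
  rw [norm_sub_rev]
  refine (norm_le_hsNorm (hs s).summable).trans (le_of_eq ?_)
  rw [hsNorm, (hs s).tsum_eq]

/-- A compact self-adjoint operator has an orthonormal basis of eigenvectors. -/
theorem exists_eigenbasis {T : H →L[ℝ] H} (hT : IsCompactOperator T) (hsa : IsSelfAdjoint T) :
    ∃ (ι : Type u) (v : HilbertBasis ι ℝ H) (d : ι → ℝ), ∀ i, T (v i) = d i • v i := by
  have hsym := hsa.isSymmetric
  have hcl : ∀ μ, IsClosed (Module.End.eigenspace (T : Module.End ℝ H) μ : Set H) := by
    intro μ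
    have : (Module.End.eigenspace (T : Module.End ℝ H) μ : Set H) = {x | T x = μ • x} := by
      ext x
      simp
    rw [this]
    exact isClosed_eq T.continuous (continuous_const_smul μ)
  have hcomp : ∀ μ, CompleteSpace (Module.End.eigenspace (T : Module.End ℝ H) μ) :=
    fun μ => (hcl μ).completeSpace_coe
  choose w b hb using fun μ =>
    exists_hilbertBasis ℝ (Module.End.eigenspace (T : Module.End ℝ H) μ)
  let f : (Σ μ : ℝ, w μ) → H := fun a => (b a.1 a.2 : H)
  have hf : Orthonormal ℝ f :=
    hsym.orthogonalFamily_eigenspaces.orthonormal_sigma_orthonormal fun μ => (b μ).orthonormal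
  -- A vector orthogonal to every `b μ` is orthogonal to each full eigenspace by expansion, and the
  -- spectral theorem leaves only zero.
  have hbot : (Submodule.span ℝ (Set.range f))ᗮ = ⊥ := by
    rw [eq_bot_iff, ← ContinuousLinearMap.orthogonalComplement_iSup_eigenspaces_eq_bot hT hsym]
    intro x hx
    rw [Submodule.mem_orthogonal'] at hx ⊢
    have hle : ∀ μ y, y ∈ Module.End.eigenspace (T : Module.End ℝ H) μ → inner ℝ x y = 0 := by
      intro μ y hy
      have h := (b μ).hasSum_repr ⟨y, hy⟩
      have h2 := (h.mapL (Submodule.subtypeL _)).mapL (innerSL ℝ x)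
      refine h2.unique ?_
      convert hasSum_zero with i
      have := hx (f ⟨μ, i⟩) (Submodule.subset_span ⟨_, rfl⟩)
      simp only [map_smul, innerSL_apply_apply, Submodule.subtypeL_apply, smul_eq_mul]
      rw [this, mul_zero]
    intro y hy
    induction hy using Submodule.iSup_induction' with
    | mem μ y hy => exact hle μ y hy
    | zero => simp
    | add y z _ _ hy hz => rw [inner_add_right, hy, hz, add_zero]
  refine ⟨_, HilbertBasis.mkOfOrthogonalEqBot hf hbot, fun a => a.1, fun a => ?_⟩
  rw [HilbertBasis.coe_mkOfOrthogonalEqBot]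
  exact Module.End.mem_eigenspace_iff.mp (b a.1 a.2).2

theorem posSqrt_mul_self {T : H →L[ℝ] H} (hT : T.IsPositive) : posSqrt (T * T) = T := by
  have hp : (T * T).IsPositive := by
    have := ContinuousLinearMap.isPositive_adjoint_comp_self T
    rwa [hT.isSelfAdjoint.adjoint_eq] at this
  obtain ⟨h1, h2⟩ := posSqrt_spec hp
  exact sqrt_unique h1 hT h2

theorem absOp_of_isPositive {T : H →L[ℝ] H} (hT : T.IsPositive) : absOp T = T := by
  rw [absOp, hT.isSelfAdjoint.adjoint_eq]
  exact posSqrt_mul_self hT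

theorem isTraceClass_iff_of_isPositive {ι : Type*} (b : HilbertBasis ι ℝ H) {T : H →L[ℝ] H}
    (hT : T.IsPositive) : IsTraceClass T ↔ Summable fun i => inner ℝ (b i) (T (b i)) := by
  rw [isTraceClass_iff b, absOp_of_isPositive hT]

theorem isHilbertSchmidt_posSqrt {T : H →L[ℝ] H} (hT : T.IsPositive) (h : IsTraceClass T) :
    IsHilbertSchmidt (posSqrt T) := by
  rw [isTraceClass_iff_of_isPositive (stdBasis H) hT] at h
  simp only [inner_eq_norm_sqrt hT] at h
  exact h

/-- `T` is the square of its root, which is Hilbert–Schmidt because `⟨x, Tx⟩ = ‖T^{1/2}x‖²`. -/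
theorem IsTraceClass.isCompactOperator {T : H →L[ℝ] H} (h : IsTraceClass T)
    (hT : T.IsPositive) : IsCompactOperator T := by
  have h1 := (isHilbertSchmidt_posSqrt hT h).isCompactOperator.clm_comp (posSqrt T)
  have h2 : (posSqrt T ∘ posSqrt T : H → H) = T := by
    conv_rhs => rw [← (posSqrt_spec hT).2]
    rfl
  rwa [h2] at h1

/-- An eigenvector of `T * T`, for positive `T`, is an eigenvector of `T`. -/
theorem apply_eq_of_apply_apply {T : H →L[ℝ] H} (hT : T.IsPositive) {d : ℝ} (hd : 0 ≤ d) {x : H}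
    (hx : T (T x) = d ^ 2 • x) : T x = d • x := by
  rcases hd.eq_or_lt with rfl | hd
  · have : inner ℝ (T x) (T x) = 0 := by
      rw [hT.inner_left_eq_inner_right, hx]
      simp
    simpa using this
  -- Since `(T + d)(T - d)x = 0`, a nonzero `y` would be an eigenvector for the negative value `-d`,
  -- against positivity.
  · set y := T x - d • x with hy
    have h1 : T y = -d • y := by
      rw [hy, map_sub, map_smul, hx]
      module
    have h2 := hT.inner_nonneg_left y
    rw [h1, inner_smul_left, real_inner_self_eq_norm_sq] at h2
    have h3 : ‖y‖ ^ 2 = 0 := by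
      have := sq_nonneg ‖y‖
      simp only [conj_trivial] at h2
      nlinarith
    exact sub_eq_zero.mp (by simpa using h3)

theorem hasSum_eigenbasis {ι : Type*} (v : HilbertBasis ι ℝ H) {T : H →L[ℝ] H}
    (hsa : IsSelfAdjoint T) {d : ι → ℝ} (hd : ∀ i, T (v i) = d i • v i) (x : H) :
    HasSum (fun i => d i * inner ℝ (v i) x ^ 2) (inner ℝ x (T x)) := by
  refine (v.hasSum_inner_mul_inner x (T x)).congr_fun fun i => ?_
  have h : inner ℝ (v i) (T x) = inner ℝ (T (v i)) x := (hsa.isSymmetric (v i) x).symm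
  rw [h, hd, real_inner_smul_left, real_inner_comm x]
  ring

theorem inner_eigenvector {x : H} (hx : ‖x‖ = 1) {T : H →L[ℝ] H} {d : ℝ} (h : T x = d • x) :
    inner ℝ x (T x) = d := by
  rw [h, inner_smul_right, real_inner_self_eq_norm_sq, hx]
  simp

theorem isPositive_of_eigenbasis {ι : Type*} (v : HilbertBasis ι ℝ H) {T : H →L[ℝ] H}
    (hsa : IsSelfAdjoint T) {d : ι → ℝ} (hd : ∀ i, T (v i) = d i • v i) (h0 : ∀ i, 0 ≤ d i) :
    T.IsPositive := by
  rw [ContinuousLinearMap.isPositive_iff']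
  refine ⟨hsa, fun x => ?_⟩
  rw [real_inner_comm]
  exact (hasSum_eigenbasis v hsa hd x).nonneg fun i => mul_nonneg (h0 i) (sq_nonneg _)

theorem absOp_eigenvector {T : H →L[ℝ] H} (hsa : IsSelfAdjoint T) {x : H} {d : ℝ}
    (hx : T x = d • x) : absOp T x = |d| • x := by
  refine apply_eq_of_apply_apply (absOp_isPositive T) (abs_nonneg d) ?_
  have h := (posSqrt_spec (ContinuousLinearMap.isPositive_adjoint_comp_self T)).2
  have h2 : absOp T (absOp T x) = (T.adjoint ∘L T) x := congrArg (· x) h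
  rw [h2, hsa.adjoint_eq, ContinuousLinearMap.comp_apply, hx, map_smul, hx, smul_smul, sq_abs, sq]

/-- In an eigenbasis this is the triangle inequality `|∑ dᵢxᵢ²| ≤ ∑ |dᵢ|xᵢ²`. It gives `-|T| ≤ T ≤
|T|`. -/
theorem abs_inner_le_inner_absOp {T : H →L[ℝ] H} (hT : IsCompactOperator T)
    (hsa : IsSelfAdjoint T) (x : H) : |inner ℝ x (T x)| ≤ inner ℝ x (absOp T x) := by
  obtain ⟨ι, v, d, hd⟩ := exists_eigenbasis hT hsa
  have h1 := hasSum_eigenbasis v hsa hd x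
  have h2 := hasSum_eigenbasis v (absOp_isPositive T).isSelfAdjoint
    (fun i => absOp_eigenvector hsa (hd i)) x
  rw [← h1.tsum_eq, ← h2.tsum_eq]
  have h3 : ∀ i, |d i| * inner ℝ (v i) x ^ 2 = ‖d i * inner ℝ (v i) x ^ 2‖ := fun i => by
    rw [Real.norm_eq_abs, abs_mul, abs_of_nonneg (sq_nonneg (inner ℝ (v i) x))]
  simp only [h3]
  exact norm_tsum_le_tsum_norm (by simpa only [h3] using h2.summable)

end Spectral

end HilbertOperator

namespace HilbertOperator

/-! ### Determinant inequalities for positive semidefinite matrices -/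

section MatrixDet

variable {n : Type*} [Fintype n] [DecidableEq n]

open Matrix

theorem posDef_one_add {K : Matrix n n ℝ} (hK : K.PosSemidef) : (1 + K).PosDef :=
  PosDef.one.add_posSemidef hK

theorem det_one_add_le_exp_trace {Z : Matrix n n ℝ} (hZ : Z.PosSemidef) :
    (1 + Z).det ≤ Real.exp Z.trace := by
  have hX := posDef_one_add hZ
  have htr : Z.trace = ∑ i, (hX.1.eigenvalues i - 1) := by
    have h := hX.1.trace_eq_sum_eigenvalues
    simp only [trace_add, trace_one, RCLike.ofReal_real_eq_id, id_eq] at h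
    rw [Finset.sum_sub_distrib, ← h]
    simp
  rw [htr, Real.exp_sum, hX.1.det_eq_prod_eigenvalues]
  simp only [RCLike.ofReal_real_eq_id, id_eq]
  refine Finset.prod_le_prod (fun i _ => (hX.eigenvalues_pos i).le) fun i _ => ?_
  have := Real.add_one_le_exp (hX.1.eigenvalues i - 1)
  linarith

theorem one_le_det_one_add {Z : Matrix n n ℝ} (hZ : Z.PosSemidef) : 1 ≤ (1 + Z).det := by
  have hX := posDef_one_add hZ
  rw [hX.1.det_eq_prod_eigenvalues]
  simp only [RCLike.ofReal_real_eq_id, id_eq]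
  refine Finset.one_le_prod fun i _ => ?_
  set v : n → ℝ := ⇑(hX.1.eigenvectorBasis i) with hv
  have h1 : (1 + Z) *ᵥ v = hX.1.eigenvalues i • v := hX.1.mulVec_eigenvectorBasis i
  have h2 : v ⬝ᵥ v = 1 := by
    have := hX.1.eigenvectorBasis.orthonormal.1 i
    have h3 := real_inner_self_eq_norm_sq (hX.1.eigenvectorBasis i)
    rw [this, EuclideanSpace.inner_eq_star_dotProduct] at h3
    simpa using h3
  have h3 := hZ.dotProduct_mulVec_nonneg v
  have h4 : Z *ᵥ v = (hX.1.eigenvalues i - 1) • v := by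
    rw [sub_smul, ← h1, add_mulVec, one_mulVec, one_smul, add_sub_cancel_left]
  rw [h4, star_trivial, dotProduct_smul, h2, smul_eq_mul] at h3
  linarith

/-- Factor out `X = 1 + K` and write `Y = B*B`. The identity `det(1 + PQ) = det(1 + QP)` yields `Z =
B X⁻¹ B*`, and `X⁻¹ ≤ 1` gives the trace bound. Bounding `det(1 + Z)` below by `1` and above by
`exp(tr Z)` then yields monotonicity and the exponential bound. -/
theorem exists_det_add {K Y : Matrix n n ℝ} (hK : K.PosSemidef) (hY : Y.PosSemidef) :
    ∃ Z : Matrix n n ℝ, Z.PosSemidef ∧ Z.trace ≤ Y.trace ∧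
      (1 + K + Y).det = (1 + K).det * (1 + Z).det := by
  have hX := posDef_one_add hK
  set X := 1 + K with hXdef
  have hu : IsUnit X.det := (isUnit_iff_isUnit_det X).mp hX.isUnit
  obtain ⟨B, hB⟩ : ∃ B : Matrix n n ℝ, Y = Bᴴ * B := by
    open scoped MatrixOrder in
    exact CStarAlgebra.nonneg_iff_eq_star_mul_self.mp hY.nonneg
  have hinv : X⁻¹.PosSemidef := hX.inv.posSemidef
  have hle : (1 - X⁻¹).PosSemidef := by
    -- `1 - X⁻¹ = X⁻¹(X² - X)X⁻¹`, where `X² - X = K + K²` is visibly positive semidefinite.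
    have h1 : 1 - X⁻¹ = X⁻¹ * (K + Kᴴ * K) * (X⁻¹)ᴴ := by
      have h2 : K + Kᴴ * K = X * X - X := by
        rw [hK.1.eq, hXdef]
        noncomm_ring
      rw [hinv.1.eq, h2, mul_sub, sub_mul, ← mul_assoc, nonsing_inv_mul X hu, one_mul, one_mul,
        mul_nonsing_inv X hu]
    rw [h1]
    exact (hK.add (posSemidef_conjTranspose_mul_self K)).mul_mul_conjTranspose_same _
  refine ⟨B * X⁻¹ * Bᴴ, hinv.mul_mul_conjTranspose_same B, ?_, ?_⟩
  · have h1 := (hle.mul_mul_conjTranspose_same B).trace_nonneg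
    rw [mul_sub, sub_mul, mul_one, trace_sub, trace_mul_comm B Bᴴ, ← hB] at h1
    linarith
  · have h1 : X + Y = X * (1 + X⁻¹ * Bᴴ * B) := by
      rw [mul_add, mul_one, hB, ← mul_assoc, ← mul_assoc, mul_nonsing_inv X hu, one_mul]
    rw [h1, det_mul, det_one_add_mul_comm, ← mul_assoc]

theorem det_one_add_le_det_add {K Y : Matrix n n ℝ} (hK : K.PosSemidef) (hY : Y.PosSemidef) :
    (1 + K).det ≤ (1 + K + Y).det := by
  obtain ⟨Z, hZ, -, h⟩ := exists_det_add hK hY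
  rw [h]
  exact le_mul_of_one_le_right (posDef_one_add hK).det_pos.le (one_le_det_one_add hZ)

theorem det_add_le_det_mul_exp_trace {K Y : Matrix n n ℝ} (hK : K.PosSemidef)
    (hY : Y.PosSemidef) : (1 + K + Y).det ≤ (1 + K).det * Real.exp Y.trace := by
  obtain ⟨Z, hZ, hZY, h⟩ := exists_det_add hK hY
  rw [h]
  exact mul_le_mul_of_nonneg_left
    ((det_one_add_le_exp_trace hZ).trans (Real.exp_le_exp.mpr hZY))
    (posDef_one_add hK).det_pos.le

/-- Compressing a positive semidefinite `N` by an isometry `U` does not increase `det(1 + N)`. -/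
theorem det_one_add_compression_le {m : Type*} [Fintype m] [DecidableEq m] {N : Matrix n n ℝ}
    (hN : N.PosSemidef) {U : Matrix n m ℝ} (hU : Uᴴ * U = 1) :
    (1 + Uᴴ * N * U).det ≤ (1 + N).det := by
  obtain ⟨C, hC⟩ : ∃ C : Matrix n n ℝ, N = Cᴴ * C := by
    open scoped MatrixOrder in
    exact CStarAlgebra.nonneg_iff_eq_star_mul_self.mp hN.nonneg
  have hproj : (1 - U * Uᴴ).PosSemidef := by
    have h1 : 1 - U * Uᴴ = (1 - U * Uᴴ)ᴴ * (1 - U * Uᴴ) := by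
      have h2 : U * Uᴴ * (U * Uᴴ) = U * Uᴴ := by
        rw [Matrix.mul_assoc, ← Matrix.mul_assoc Uᴴ, hU, Matrix.one_mul]
      simp only [conjTranspose_sub, conjTranspose_one, conjTranspose_mul,
        conjTranspose_conjTranspose, mul_sub, sub_mul, mul_one, one_mul, h2]
      abel
    rw [h1]
    exact posSemidef_conjTranspose_mul_self _
  -- Cycling the factors puts both determinants on the same space; they differ by replacing the
  -- projection `UU*` with `1`, which adds a positive semidefinite term.
  have h1 : (1 + Uᴴ * N * U).det = (1 + C * (U * Uᴴ) * Cᴴ).det := by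
    rw [hC, show Uᴴ * (Cᴴ * C) * U = (Uᴴ * Cᴴ) * (C * U) by simp only [Matrix.mul_assoc],
      det_one_add_mul_comm]
    simp only [Matrix.mul_assoc]
  have h2 : (1 + N).det = (1 + C * (U * Uᴴ) * Cᴴ + C * (1 - U * Uᴴ) * Cᴴ).det := by
    rw [hC, det_one_add_mul_comm]
    congr 1
    rw [mul_sub, sub_mul, mul_one]
    abel
  rw [h1, h2]
  exact det_one_add_le_det_add ((posSemidef_self_mul_conjTranspose U).mul_mul_conjTranspose_same C)
    (hproj.mul_mul_conjTranspose_same C)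

end MatrixDet

/-! ### Compressions and the Fredholm determinant -/

section Fredholm

universe u

variable {H : Type u} [NormedAddCommGroup H] [InnerProductSpace ℝ H] {n m : Type*}

/-- The matrix `⟨bᵢ, T bⱼ⟩`. -/
def compressionMatrix (T : H →L[ℝ] H) (b : n → H) : Matrix n n ℝ :=
  Matrix.of fun i j => inner ℝ (b i) (T (b j))

theorem compressionMatrix_add (S T : H →L[ℝ] H) (b : n → H) :
    compressionMatrix (S + T) b = compressionMatrix S b + compressionMatrix T b := by
  ext i j
  simp [compressionMatrix, inner_add_right]

variable [CompleteSpace H]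

theorem compressionDet_eq [Fintype n] [DecidableEq n] (T : H →L[ℝ] H) (s : Finset H)
    (b : OrthonormalBasis n ℝ (Submodule.span ℝ (s : Set H))) :
    compressionDet T s = (1 + compressionMatrix T fun i => (b i : H)).det := by
  rw [compressionDet, ← LinearMap.det_toMatrix b.toBasis, map_add, LinearMap.toMatrix_id]
  congr 2
  ext i j
  rw [LinearMap.toMatrix_apply]
  simp [compressionMatrix, OrthonormalBasis.repr_apply_apply]

theorem compressionMatrix_posSemidef [Fintype n] {T : H →L[ℝ] H} (hT : T.IsPositive) (b : n → H) :
    (compressionMatrix T b).PosSemidef := by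
  refine Matrix.PosSemidef.of_dotProduct_mulVec_nonneg ?_ fun x => ?_
  · ext i j
    simp only [compressionMatrix, Matrix.conjTranspose_apply, Matrix.of_apply, star_trivial]
    rw [real_inner_comm, hT.inner_left_eq_inner_right]
  · have h := hT.inner_nonneg_right (∑ i, x i • b i)
    convert h using 1
    simp only [dotProduct, Matrix.mulVec, compressionMatrix, Matrix.of_apply, map_sum, map_smul,
      sum_inner, inner_sum, real_inner_smul_left, real_inner_smul_right, star_trivial,
      Finset.mul_sum]
    rw [Finset.sum_comm]
    refine Finset.sum_congr rfl fun i _ => Finset.sum_congr rfl fun j _ => ?_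
    ring

/-- Extending `b` to a Hilbert basis makes the left side a finite partial sum of the nonnegative
series for the trace, which is basis independent for positive `T`. -/
theorem trace_compressionMatrix_le [Fintype n] {T : H →L[ℝ] H} (hT : T.IsPositive)
    (h : IsTraceClass T) {b : n → H} (hb : Orthonormal ℝ b) :
    (compressionMatrix T b).trace ≤ trace T := by
  classical
  obtain ⟨w, v, hw, hv⟩ := hb.toSubtypeRange.exists_hilbertBasis_extension
  rw [trace_eq_of_isPositive v hT]
  have hs := (isTraceClass_iff_of_isPositive v hT).mp h
  let e : n → w := fun i => ⟨b i, hw ⟨i, rfl⟩⟩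
  have he : Function.Injective e := fun i j hij =>
    hb.linearIndependent.injective (congrArg Subtype.val hij)
  have h1 : (compressionMatrix T b).trace =
      ∑ a ∈ Finset.univ.map ⟨e, he⟩, inner ℝ (v a) (T (v a)) := by
    simp [Matrix.trace, compressionMatrix, hv, e]
  rw [h1]
  exact hs.sum_le_tsum _ fun a _ => hT.inner_nonneg_right _

theorem one_le_compressionDet {T : H →L[ℝ] H} (hT : T.IsPositive) (s : Finset H) :
    1 ≤ compressionDet T s := by
  have : FiniteDimensional ℝ (Submodule.span ℝ (s : Set H)) := FiniteDimensional.span_finset ℝ s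
  rw [compressionDet_eq T s (stdOrthonormalBasis ℝ _)]
  exact one_le_det_one_add (compressionMatrix_posSemidef hT _)

/-- The smaller span sits isometrically in the larger one, so `det_one_add_compression_le` applies
to the matrix `U` expressing one orthonormal basis in the other. With boundedness this gives
existence of the limit. -/
theorem compressionDet_mono {T : H →L[ℝ] H} (hT : T.IsPositive) : Monotone (compressionDet T) := by
  intro s t hst
  have : FiniteDimensional ℝ (Submodule.span ℝ (s : Set H)) := FiniteDimensional.span_finset ℝ s
  have : FiniteDimensional ℝ (Submodule.span ℝ (t : Set H)) := FiniteDimensional.span_finset ℝ t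
  set b := stdOrthonormalBasis ℝ (Submodule.span ℝ (s : Set H))
  set c := stdOrthonormalBasis ℝ (Submodule.span ℝ (t : Set H))
  rw [compressionDet_eq T s b, compressionDet_eq T t c]
  have hle : Submodule.span ℝ (s : Set H) ≤ Submodule.span ℝ (t : Set H) :=
    Submodule.span_mono (by exact_mod_cast hst)
  have hb : ∀ j, (b j : H) = ∑ k, inner ℝ (c k : H) (b j : H) • (c k : H) := by
    intro j
    have := congrArg Subtype.val (c.sum_repr' ⟨b j, hle (b j).2⟩)
    simpa using this.symm
  have hin : ∀ (i) (x : H), inner ℝ (b i : H) x =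
      ∑ k, inner ℝ (c k : H) (b i : H) * inner ℝ (c k : H) x := by
    intro i x
    conv_lhs => rw [hb i]
    simp only [sum_inner, real_inner_smul_left]
  let U : Matrix _ _ ℝ := Matrix.of fun k j => inner ℝ (c k : H) (b j : H)
  have hU : U.conjTranspose * U = 1 := by
    ext i j
    have h1 := hin i (b j)
    have h2 := (orthonormal_iff_ite.mp b.orthonormal) i j
    rw [Submodule.coe_inner, h1] at h2
    simpa [Matrix.mul_apply, U, Matrix.one_apply] using h2
  have hN : compressionMatrix T (fun i => (b i : H)) =
      U.conjTranspose * compressionMatrix T (fun i => (c i : H)) * U := by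
    ext i j
    simp only [compressionMatrix, Matrix.mul_apply, U, Matrix.conjTranspose_apply, Matrix.of_apply,
      star_trivial]
    conv_lhs => rw [hin i, hb j]
    simp only [map_sum, map_smul, inner_sum, real_inner_smul_right, Finset.mul_sum, Finset.sum_mul]
    rw [Finset.sum_comm]
    refine Finset.sum_congr rfl fun i _ => Finset.sum_congr rfl fun j _ => ?_
    ring
  rw [hN]
  exact det_one_add_compression_le (compressionMatrix_posSemidef hT _) hU

/-- From `S ≤ T + P`, monotonicity moves from `S` to `T + P`, and the exponential bound then removes
`P`. The factor is independent of `s`, so the estimate survives the limit. -/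
theorem compressionDet_le_mul_exp {S T P : H →L[ℝ] H} (hS : S.IsPositive) (hT : T.IsPositive)
    (hP : P.IsPositive) (htr : IsTraceClass P) (hle : (T + P - S).IsPositive) (s : Finset H) :
    compressionDet S s ≤ compressionDet T s * Real.exp (trace P) := by
  have : FiniteDimensional ℝ (Submodule.span ℝ (s : Set H)) := FiniteDimensional.span_finset ℝ s
  set b := stdOrthonormalBasis ℝ (Submodule.span ℝ (s : Set H))
  rw [compressionDet_eq S s b, compressionDet_eq T s b]
  set f := fun i => (b i : H)
  have hf : Orthonormal ℝ f := b.orthonormal.comp_linearIsometry (Submodule.subtypeₗᵢ _)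
  have h1 := det_one_add_le_det_add (compressionMatrix_posSemidef hS f)
    (compressionMatrix_posSemidef hle f)
  have h2 := det_add_le_det_mul_exp_trace (compressionMatrix_posSemidef hT f)
    (compressionMatrix_posSemidef hP f)
  rw [add_assoc, ← compressionMatrix_add] at h1 h2
  rw [add_sub_cancel] at h1
  refine h1.trans (h2.trans (mul_le_mul_of_nonneg_left ?_ ?_))
  · exact Real.exp_le_exp.mpr (trace_compressionMatrix_le hP htr hf)
  · exact (posDef_one_add (compressionMatrix_posSemidef hT f)).det_pos.le

theorem compressionDet_zero (s : Finset H) : compressionDet (0 : H →L[ℝ] H) s = 1 := by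
  simp [compressionDet]

/-- The Fredholm determinant of `I + T` exists and is at least `1` for positive trace class `T`. -/
theorem exists_hasFredholmDet {T : H →L[ℝ] H} (hT : T.IsPositive) (h : IsTraceClass T) :
    ∃ d, 1 ≤ d ∧ HasFredholmDet T d := by
  have hb : BddAbove (Set.range (compressionDet T)) := by
    refine ⟨Real.exp (trace T), ?_⟩
    rintro _ ⟨s, rfl⟩
    -- Comparison with the zero operator, `T ≤ 0 + T`, gives the uniform bound `exp(tr T)`.
    have := compressionDet_le_mul_exp hT (ContinuousLinearMap.isPositive_zero) hT h
      (by simp) s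
    simpa [compressionDet_zero] using this
  have ht : HasFredholmDet T _ := tendsto_atTop_ciSup (compressionDet_mono hT) hb
  exact ⟨_, ge_of_tendsto' ht (one_le_compressionDet hT), ht⟩

theorem HasFredholmDet.fredholmDet_eq {T : H →L[ℝ] H} {d : ℝ} (h : HasFredholmDet T d) :
    fredholmDet T = d :=
  h.limUnder_eq

theorem log_fredholmDet_le {S T P : H →L[ℝ] H} (hS : S.IsPositive) (hS' : IsTraceClass S)
    (hT : T.IsPositive) (hT' : IsTraceClass T) (hP : P.IsPositive) (hP' : IsTraceClass P)
    (hle : (T + P - S).IsPositive) :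
    Real.log (fredholmDet S) ≤ Real.log (fredholmDet T) + trace P := by
  obtain ⟨d, hd, h⟩ := exists_hasFredholmDet hS hS'
  obtain ⟨e, he, h'⟩ := exists_hasFredholmDet hT hT'
  rw [h.fredholmDet_eq, h'.fredholmDet_eq]
  have h1 : d ≤ e * Real.exp (trace P) :=
    le_of_tendsto_of_tendsto' h (Tendsto.mul_const (Real.exp (trace P)) h')
      (compressionDet_le_mul_exp hS hT hP hP' hle)
  have h2 := Real.log_le_log (by linarith) h1
  rwa [Real.log_mul (by linarith) (Real.exp_ne_zero _), Real.log_exp] at h2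

end Fredholm

end HilbertOperator

namespace HilbertOperator

/-! ### Lipschitz estimates for `M` and `G` -/

section Estimates

universe u

variable {H : Type u} {K : Type*} [NormedAddCommGroup H] [InnerProductSpace ℝ H] [CompleteSpace H]
  [NormedAddCommGroup K] [InnerProductSpace ℝ K] [CompleteSpace K]

theorem isPositive_one_add_sq_smul (c : ℝ) {A : H →L[ℝ] H} (hA : A.IsPositive) :
    (1 + c ^ 2 • A).IsPositive :=
  ContinuousLinearMap.isPositive_one.add (hA.smul_of_nonneg (sq_nonneg c))

theorem opM_apply_eigenvector (c : ℝ) {A : H →L[ℝ] H} (hA : A.IsPositive) {x : H} {a : ℝ}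
    (ha : 0 ≤ a) (hx : A x = a • x) :
    opM c A x = (Real.sqrt (1 + c ^ 2 * a) - 1) • x := by
  obtain ⟨h1, h2⟩ := posSqrt_spec (isPositive_one_add_sq_smul c hA)
  have h3 : posSqrt (1 + c ^ 2 • A) x = Real.sqrt (1 + c ^ 2 * a) • x := by
    refine apply_eq_of_apply_apply h1 (Real.sqrt_nonneg _) ?_
    have h4 := congrArg (· x) h2
    rw [Real.sq_sqrt (by positivity), add_smul, one_smul, mul_smul, ← hx]
    exact h4
  rw [opM, add_apply, h3]
  simp only [neg_apply, one_apply_eq_self]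
  module

theorem isSelfAdjoint_opM (c : ℝ) {A : H →L[ℝ] H} (hA : A.IsPositive) :
    IsSelfAdjoint (opM c A) :=
  ((IsSelfAdjoint.one _).neg).add (posSqrt_spec (isPositive_one_add_sq_smul c hA)).1.isSelfAdjoint

theorem opM_isPositive_and_isTraceClass (c : ℝ) {A : H →L[ℝ] H} (hA : A.IsPositive)
    (htr : IsTraceClass A) : (opM c A).IsPositive ∧ IsTraceClass (opM c A) := by
  obtain ⟨ι, v, a, ha⟩ := exists_eigenbasis (htr.isCompactOperator hA) hA.isSelfAdjoint
  have hv : ∀ i, ‖v i‖ = 1 := v.orthonormal.1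
  have ha0 : ∀ i, 0 ≤ a i := fun i => by
    rw [← inner_eigenvector (hv i) (ha i)]
    exact hA.inner_nonneg_right _
  have hM := fun i => opM_apply_eigenvector c hA (ha0 i) (ha i)
  have hM0 : ∀ i, 0 ≤ Real.sqrt (1 + c ^ 2 * a i) - 1 := fun i => by
    have : 0 ≤ c ^ 2 * a i := mul_nonneg (sq_nonneg c) (ha0 i)
    rw [sub_nonneg, Real.one_le_sqrt]
    linarith
  have hpos := isPositive_of_eigenbasis v (isSelfAdjoint_opM c hA) hM hM0
  refine ⟨hpos, ?_⟩
  rw [isTraceClass_iff_of_isPositive v hpos]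
  rw [isTraceClass_iff_of_isPositive v hA] at htr
  simp only [fun i => inner_eigenvector (hv i) (hM i)]
  simp only [fun i => inner_eigenvector (hv i) (ha i)] at htr
  refine Summable.of_nonneg_of_le hM0 (fun i => ?_) (htr.mul_left (c ^ 2 / 2))
  -- `√(1 + x) - 1 ≤ x/2` dominates the eigenvalues of `M(A)` by `c²/2` times those of `A`.
  have := Real.sqrt_one_add_le (x := c ^ 2 * a i) (by nlinarith [mul_nonneg (sq_nonneg c) (ha0 i)])
  linarith

theorem exists_eigenbasis_sub {A B : H →L[ℝ] H} (hA : A.IsPositive) (hA' : IsTraceClass A)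
    (hB : B.IsPositive) (hB' : IsTraceClass B) :
    ∃ (ι : Type u) (v : HilbertBasis ι ℝ H) (d : ι → ℝ), ∀ i, (A - B) (v i) = d i • v i := by
  refine exists_eigenbasis ?_ (hA.isSelfAdjoint.sub hB.isSelfAdjoint)
  exact (hA'.isCompactOperator hA).sub (hB'.isCompactOperator hB)

/-- On an eigenbasis of `A - B`, `|dᵢ| = |⟨vᵢ, Avᵢ⟩ - ⟨vᵢ, Bvᵢ⟩|` is at most the sum of two summable
nonnegative terms. -/
theorem isTraceClass_sub {A B : H →L[ℝ] H} (hA : A.IsPositive) (hA' : IsTraceClass A)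
    (hB : B.IsPositive) (hB' : IsTraceClass B) : IsTraceClass (A - B) := by
  obtain ⟨ι, v, d, hd⟩ := exists_eigenbasis_sub hA hA' hB hB'
  have hsa := hA.isSelfAdjoint.sub hB.isSelfAdjoint
  have hv : ∀ i, ‖v i‖ = 1 := v.orthonormal.1
  rw [isTraceClass_iff v]
  rw [isTraceClass_iff_of_isPositive v hA] at hA'
  rw [isTraceClass_iff_of_isPositive v hB] at hB'
  refine Summable.of_nonneg_of_le (fun i => (absOp_isPositive _).inner_nonneg_right _)
    (fun i => ?_) (hA'.add hB')
  rw [inner_eigenvector (hv i) (absOp_eigenvector hsa (hd i)), ← inner_eigenvector (hv i) (hd i),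
    sub_apply, inner_sub_right]
  have h1 := hA.inner_nonneg_right (v i)
  have h2 := hB.inner_nonneg_right (v i)
  rw [abs_le]
  constructor <;> linarith

/-- `M` is Lipschitz with constant `c² / 2` for the trace norm. -/
theorem traceNorm_opM_sub_le (c : ℝ) {A B : H →L[ℝ] H} (hA : A.IsPositive)
    (hA' : IsTraceClass A) (hB : B.IsPositive) (hB' : IsTraceClass B) :
    traceNorm (opM c A - opM c B) ≤ c ^ 2 / 2 * traceNorm (A - B) := by
  obtain ⟨hMA, hMA'⟩ := opM_isPositive_and_isTraceClass c hA hA'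
  obtain ⟨hMB, hMB'⟩ := opM_isPositive_and_isTraceClass c hB hB'
  obtain ⟨ι, v, d, hd⟩ := exists_eigenbasis_sub hMA hMA' hMB hMB'
  have hv : ∀ i, ‖v i‖ = 1 := v.orthonormal.1
  have htr := (isTraceClass_iff v _).mp (isTraceClass_sub hA hA' hB hB')
  rw [traceNorm_eq v, traceNorm_eq v, ← tsum_mul_left]
  refine Summable.tsum_le_tsum (fun i => ?_)
    ((isTraceClass_iff v _).mp (isTraceClass_sub hMA hMA' hMB hMB')) (htr.mul_left _)
  rw [inner_eigenvector (hv i)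
    (absOp_eigenvector (hMA.isSelfAdjoint.sub hMB.isSelfAdjoint) (hd i))]
  have hcomp : IsCompactOperator ⇑(A - B) :=
    (hA'.isCompactOperator hA).sub (hB'.isCompactOperator hB)
  have h1 := abs_inner_le_inner_absOp hcomp (hA.isSelfAdjoint.sub hB.isSelfAdjoint) (v i)
  set S := posSqrt (1 + c ^ 2 • A)
  set R := posSqrt (1 + c ^ 2 • B)
  have hSS : S * S = 1 + c ^ 2 • A := (posSqrt_spec (isPositive_one_add_sq_smul c hA)).2
  have hRR : R * R = 1 + c ^ 2 • B := (posSqrt_spec (isPositive_one_add_sq_smul c hB)).2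
  have hD : opM c A - opM c B = S - R := by
    rw [opM, opM]
    abel
  -- This splitting of `S² - R²` needs no commutation of `S` and `R`, and puts `S - R` next to `v i`
  -- on one side in each term.
  have hsyl : c ^ 2 • (A - B) = S * (S - R) + (S - R) * R := by
    have : S * (S - R) + (S - R) * R = S * S - R * R := by noncomm_ring
    rw [this, hSS, hRR, smul_sub]
    abel
  -- Positivity of `M(N)` says that the square root dominates the identity; this supplies the `2` in
  -- `c²/2`.
  have hge : ∀ {N : H →L[ℝ] H}, (opM c N).IsPositive →
      1 ≤ inner ℝ (v i) (posSqrt (1 + c ^ 2 • N) (v i)) := by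
    intro N hN
    have := hN.inner_nonneg_right (v i)
    rw [opM, add_apply, inner_add_right, neg_apply, one_apply_eq_self, inner_neg_right,
      real_inner_self_eq_norm_sq, hv] at this
    linarith
  have hdi : (S - R) (v i) = d i • v i := by rw [← hD, hd]
  have hDsa : IsSelfAdjoint (S - R) := hD ▸ hMA.isSelfAdjoint.sub hMB.isSelfAdjoint
  have h2 : inner ℝ (v i) ((c ^ 2 • (A - B)) (v i)) =
      d i * (inner ℝ (v i) (S (v i)) + inner ℝ (v i) (R (v i))) := by
    have h3 : inner ℝ (v i) ((S - R) (R (v i))) = inner ℝ ((S - R) (v i)) (R (v i)) :=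
      (hDsa.isSymmetric (v i) (R (v i))).symm
    rw [hsyl, add_apply, inner_add_right, mul_apply_eq_comp, mul_apply_eq_comp, h3, hdi, map_smul,
      real_inner_smul_left, real_inner_smul_right]
    ring
  rw [smul_apply, real_inner_smul_right] at h2
  have h3 := congrArg abs h2
  have h4 : 1 ≤ inner ℝ (v i) (S (v i)) := hge hMA
  have h5 : 1 ≤ inner ℝ (v i) (R (v i)) := hge hMB
  rw [abs_mul, abs_mul, abs_of_nonneg (sq_nonneg c),
    abs_of_nonneg (add_nonneg (zero_le_one.trans h4) (zero_le_one.trans h5))] at h3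
  have h6 := mul_le_mul_of_nonneg_left h1 (sq_nonneg c)
  have h7 := mul_le_mul_of_nonneg_left (add_le_add h4 h5) (abs_nonneg (d i))
  linarith

theorem half_smul_isPositive_and_isTraceClass {T : H →L[ℝ] H} (hT : T.IsPositive)
    (hT' : IsTraceClass T) : ((1 / 2 : ℝ) • T).IsPositive ∧ IsTraceClass ((1 / 2 : ℝ) • T) := by
  have h1 : ((1 / 2 : ℝ) • T).IsPositive := hT.smul_of_nonneg (by norm_num)
  refine ⟨h1, ?_⟩
  rw [isTraceClass_iff_of_isPositive (stdBasis H) hT] at hT'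
  rw [isTraceClass_iff_of_isPositive (stdBasis H) h1]
  simpa only [smul_apply, real_inner_smul_right] using hT'.mul_left (1 / 2)

theorem opG_sub_le (c : ℝ) {A B : H →L[ℝ] H} (hA : A.IsPositive) (hA' : IsTraceClass A)
    (hB : B.IsPositive) (hB' : IsTraceClass B) :
    |opG c A - opG c B| ≤ 3 * c ^ 2 / 4 * traceNorm (A - B) := by
  obtain ⟨hMA, hMA'⟩ := opM_isPositive_and_isTraceClass c hA hA'
  obtain ⟨hMB, hMB'⟩ := opM_isPositive_and_isTraceClass c hB hB'
  have hL := traceNorm_opM_sub_le c hA hA' hB hB'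
  set S := opM c A
  set R := opM c B
  have hcomp : IsCompactOperator ⇑(S - R) :=
    (hMA'.isCompactOperator hMA).sub (hMB'.isCompactOperator hMB)
  have hsa := hMA.isSelfAdjoint.sub hMB.isSelfAdjoint
  have habs := abs_inner_le_inner_absOp hcomp hsa
  have hD := absOp_isPositive (S - R)
  have hD' := isTraceClass_sub hMA hMA' hMB hMB'
  have hsS := (isTraceClass_iff_of_isPositive (stdBasis H) hMA).mp hMA'
  have hsR := (isTraceClass_iff_of_isPositive (stdBasis H) hMB).mp hMB'
  have htr : |trace S - trace R| ≤ traceNorm (S - R) := by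
    rw [trace, trace, ← hsS.tsum_sub hsR, traceNorm]
    have h1 : ∀ i, ‖inner ℝ (stdBasis H i) (S (stdBasis H i)) -
        inner ℝ (stdBasis H i) (R (stdBasis H i))‖ ≤
        inner ℝ (stdBasis H i) (absOp (S - R) (stdBasis H i)) := fun i => by
      rw [← inner_sub_right, ← sub_apply]
      exact habs _
    exact tsum_of_norm_bounded hD'.hasSum h1
  have habsT : IsTraceClass (absOp (S - R)) := by
    rw [isTraceClass_iff_of_isPositive (stdBasis H) hD]
    exact hD'
  have htrhalf : trace ((1 / 2 : ℝ) • absOp (S - R)) = 1 / 2 * traceNorm (S - R) := by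
    simp only [trace, traceNorm, smul_apply, real_inner_smul_right, tsum_mul_left]
  -- Stated for general `X`, `Y` so that it serves both orders of `S` and `R`, giving both sides of
  -- the bound on the logarithms.
  have hpos : ∀ {X Y : H →L[ℝ] H}, IsSelfAdjoint X → IsSelfAdjoint Y →
      (∀ x, -inner ℝ x (absOp (S - R) x) ≤ inner ℝ x ((Y - X) x)) →
      ((1 / 2 : ℝ) • Y + (1 / 2 : ℝ) • absOp (S - R) - (1 / 2 : ℝ) • X).IsPositive := by
    intro X Y hX hY h
    have h1 : (1 / 2 : ℝ) • Y + (1 / 2 : ℝ) • absOp (S - R) - (1 / 2 : ℝ) • X =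
        (1 / 2 : ℝ) • ((Y - X) + absOp (S - R)) := by
      rw [smul_add, smul_sub]
      abel
    rw [h1]
    refine ContinuousLinearMap.IsPositive.smul_of_nonneg ?_ (by norm_num)
    rw [ContinuousLinearMap.isPositive_iff']
    refine ⟨(hY.sub hX).add hD.isSelfAdjoint, fun x => ?_⟩
    rw [real_inner_comm, add_apply, inner_add_right]
    linarith [h x]
  have hSh := half_smul_isPositive_and_isTraceClass hMA hMA'
  have hRh := half_smul_isPositive_and_isTraceClass hMB hMB'
  have hDh := half_smul_isPositive_and_isTraceClass hD habsT
  have hlog1 := log_fredholmDet_le hSh.1 hSh.2 hRh.1 hRh.2 hDh.1 hDh.2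
    (hpos hMA.isSelfAdjoint hMB.isSelfAdjoint fun x => by
      rw [← neg_sub S R, neg_apply, inner_neg_right]
      exact neg_le_neg ((le_abs_self _).trans (habs x)))
  have hlog2 := log_fredholmDet_le hRh.1 hRh.2 hSh.1 hSh.2 hDh.1 hDh.2
    (hpos hMB.isSelfAdjoint hMA.isSelfAdjoint fun x => (abs_le.mp (habs x)).1)
  rw [htrhalf] at hlog1 hlog2
  rw [abs_le] at htr
  simp only [opG]
  rw [abs_le]
  constructor <;> linarith

/-! ### Hilbert–Schmidt estimates -/

theorem adjoint_comp_self_isPositive_and_isTraceClass {A : H →L[ℝ] K} (hA : IsHilbertSchmidt A) :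
    (A.adjoint ∘L A).IsPositive ∧ IsTraceClass (A.adjoint ∘L A) := by
  have h := ContinuousLinearMap.isPositive_adjoint_comp_self A
  refine ⟨h, ?_⟩
  rw [isTraceClass_iff_of_isPositive (stdBasis H) h]
  simp only [ContinuousLinearMap.comp_apply, ContinuousLinearMap.adjoint_inner_right,
    real_inner_self_eq_norm_sq]
  exact hA

theorem IsHilbertSchmidt.sub {A B : H →L[ℝ] K} (hA : IsHilbertSchmidt A)
    (hB : IsHilbertSchmidt B) : IsHilbertSchmidt (A - B) := by
  refine Summable.of_nonneg_of_le (fun i => sq_nonneg _) (fun i => ?_)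
    ((Summable.mul_left 2 hA).add (Summable.mul_left 2 hB))
  rw [sub_apply]
  have h1 := norm_sub_le (A (stdBasis H i)) (B (stdBasis H i))
  have h2 := pow_le_pow_left₀ (norm_nonneg _) h1 2
  have := sq_nonneg (‖A (stdBasis H i)‖ - ‖B (stdBasis H i)‖)
  nlinarith

theorem summable_and_tsum_norm_mul_norm_le {ι : Type*} (b : HilbertBasis ι ℝ H) {A B : H →L[ℝ] K}
    (hA : IsHilbertSchmidt A) (hB : IsHilbertSchmidt B) :
    Summable (fun i => ‖A (b i)‖ * ‖B (b i)‖) ∧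
      ∑' i, ‖A (b i)‖ * ‖B (b i)‖ ≤ hsNorm A * hsNorm B := by
  have h2 : (2 : ℝ).HolderConjugate 2 := Real.HolderConjugate.two_two
  have h := Real.summable_and_inner_le_Lp_mul_Lq_tsum_of_nonneg h2
    (fun i => norm_nonneg (A (b i))) (fun i => norm_nonneg (B (b i)))
    (by simpa using (isHilbertSchmidt_iff b A).mp hA)
    (by simpa using (isHilbertSchmidt_iff b B).mp hB)
  rw [hsNorm_eq b, hsNorm_eq b, Real.sqrt_eq_rpow, Real.sqrt_eq_rpow]
  simpa using h

/-- On an eigenbasis of `A*A - B*B` the eigenvalues are `‖Avᵢ‖² - ‖Bvᵢ‖²`. Factoring the difference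
of squares bounds them by `(‖Avᵢ‖ + ‖Bvᵢ‖)‖(A - B)vᵢ‖`, and Cauchy–Schwarz sums each product. -/
theorem traceNorm_adjoint_comp_self_sub_le {A B : H →L[ℝ] K} (hA : IsHilbertSchmidt A)
    (hB : IsHilbertSchmidt B) : traceNorm (A.adjoint ∘L A - B.adjoint ∘L B) ≤
      (hsNorm A + hsNorm B) * hsNorm (A - B) := by
  obtain ⟨hA1, hA2⟩ := adjoint_comp_self_isPositive_and_isTraceClass hA
  obtain ⟨hB1, hB2⟩ := adjoint_comp_self_isPositive_and_isTraceClass hB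
  obtain ⟨ι, v, d, hd⟩ := exists_eigenbasis_sub hA1 hA2 hB1 hB2
  have hv : ∀ i, ‖v i‖ = 1 := v.orthonormal.1
  obtain ⟨s1, l1⟩ := summable_and_tsum_norm_mul_norm_le v hA (hA.sub hB)
  obtain ⟨s2, l2⟩ := summable_and_tsum_norm_mul_norm_le v hB (hA.sub hB)
  rw [traceNorm_eq v, add_mul]
  refine le_trans ?_ (add_le_add l1 l2)
  rw [← s1.tsum_add s2]
  refine Summable.tsum_le_tsum (fun i => ?_)
    ((isTraceClass_iff v _).mp (isTraceClass_sub hA1 hA2 hB1 hB2)) (s1.add s2)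
  rw [inner_eigenvector (hv i) (absOp_eigenvector (hA1.isSelfAdjoint.sub hB1.isSelfAdjoint) (hd i)),
    ← inner_eigenvector (hv i) (hd i)]
  simp only [sub_apply, inner_sub_right, ContinuousLinearMap.comp_apply,
    ContinuousLinearMap.adjoint_inner_right, real_inner_self_eq_norm_sq]
  rw [sq_sub_sq, abs_mul, ← add_mul, abs_of_nonneg (by positivity)]
  exact mul_le_mul_of_nonneg_left (abs_norm_sub_norm_le _ _) (by positivity)

theorem opG_adjoint_comp_self_sub_le (c : ℝ) {A B : H →L[ℝ] K} (hA : IsHilbertSchmidt A)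
    (hB : IsHilbertSchmidt B) :
    |opG c (A.adjoint ∘L A) - opG c (B.adjoint ∘L B)| ≤
      3 * c ^ 2 / 4 * (hsNorm A + hsNorm B) * hsNorm (A - B) := by
  obtain ⟨hA1, hA2⟩ := adjoint_comp_self_isPositive_and_isTraceClass hA
  obtain ⟨hB1, hB2⟩ := adjoint_comp_self_isPositive_and_isTraceClass hB
  refine (opG_sub_le c hA1 hA2 hB1 hB2).trans ?_
  rw [mul_assoc (3 * c ^ 2 / 4)]
  exact mul_le_mul_of_nonneg_left (traceNorm_adjoint_comp_self_sub_le hA hB) (by positivity)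

end Estimates

end HilbertOperator

theorem mainTheorem11 (c : ℝ) (hc : c ≠ 0)
    {H H₁ H₂ : Type*}
    [NormedAddCommGroup H] [InnerProductSpace ℝ H] [CompleteSpace H]
    [TopologicalSpace.SeparableSpace H]
    [NormedAddCommGroup H₁] [InnerProductSpace ℝ H₁] [CompleteSpace H₁]
    [TopologicalSpace.SeparableSpace H₁]
    [NormedAddCommGroup H₂] [InnerProductSpace ℝ H₂] [CompleteSpace H₂]
    [TopologicalSpace.SeparableSpace H₂] :
    -- `G` is well defined on positive trace class operators
    (∀ A : H →L[ℝ] H, A.IsPositive → HilbertOperator.IsTraceClass A →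
      (HilbertOperator.opM c A).IsPositive ∧
      HilbertOperator.IsTraceClass (HilbertOperator.opM c A) ∧
      ∃ d : ℝ, 0 < d ∧ HilbertOperator.HasFredholmDet ((1 / 2 : ℝ) • HilbertOperator.opM c A) d) ∧
    -- trace norm bound
    (∀ A B : H →L[ℝ] H,
      A.IsPositive → HilbertOperator.IsTraceClass A →
      B.IsPositive → HilbertOperator.IsTraceClass B →
      |HilbertOperator.opG c A - HilbertOperator.opG c B| ≤
        3 * c ^ 2 / 4 * HilbertOperator.traceNorm (A - B)) ∧
    -- squares of self-adjoint Hilbert-Schmidt operators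
    (∀ A B : H →L[ℝ] H,
      IsSelfAdjoint A → HilbertOperator.IsHilbertSchmidt A →
      IsSelfAdjoint B → HilbertOperator.IsHilbertSchmidt B →
      ((A ^ 2).IsPositive ∧ HilbertOperator.IsTraceClass (A ^ 2)) ∧
      ((B ^ 2).IsPositive ∧ HilbertOperator.IsTraceClass (B ^ 2)) ∧
      |HilbertOperator.opG c (A ^ 2) - HilbertOperator.opG c (B ^ 2)| ≤
        3 * c ^ 2 / 4 * (HilbertOperator.hsNorm A + HilbertOperator.hsNorm B) *
          HilbertOperator.hsNorm (A - B)) ∧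
    -- Hilbert-Schmidt operators between two spaces
    (∀ A B : H₁ →L[ℝ] H₂,
      HilbertOperator.IsHilbertSchmidt A → HilbertOperator.IsHilbertSchmidt B →
      ((A.adjoint ∘L A).IsPositive ∧ HilbertOperator.IsTraceClass (A.adjoint ∘L A)) ∧
      ((B.adjoint ∘L B).IsPositive ∧ HilbertOperator.IsTraceClass (B.adjoint ∘L B)) ∧
      |HilbertOperator.opG c (A.adjoint ∘L A) - HilbertOperator.opG c (B.adjoint ∘L B)| ≤
        3 * c ^ 2 / 4 * (HilbertOperator.hsNorm A + HilbertOperator.hsNorm B) *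
          HilbertOperator.hsNorm (A - B)) := by
  refine ⟨fun A hA hA' => ?_, fun A B hA hA' hB hB' =>
    HilbertOperator.opG_sub_le c hA hA' hB hB', fun A B hA hA' hB hB' => ?_, fun A B hA hB =>
    ⟨HilbertOperator.adjoint_comp_self_isPositive_and_isTraceClass hA,
      HilbertOperator.adjoint_comp_self_isPositive_and_isTraceClass hB,
      HilbertOperator.opG_adjoint_comp_self_sub_le c hA hB⟩⟩
  · obtain ⟨h1, h2⟩ := HilbertOperator.opM_isPositive_and_isTraceClass c hA hA'
    obtain ⟨h3, h4⟩ := HilbertOperator.half_smul_isPositive_and_isTraceClass h1 h2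
    obtain ⟨d, hd, h⟩ := HilbertOperator.exists_hasFredholmDet h3 h4
    exact ⟨h1, h2, d, zero_lt_one.trans_le hd, h⟩
  -- The self-adjoint case is the two-space case with equal spaces.
  · have hsq : ∀ {T : H →L[ℝ] H}, IsSelfAdjoint T → T ^ 2 = T.adjoint ∘L T := fun {T} hT => by
      rw [hT.adjoint_eq, sq]
      rfl
    rw [hsq hA, hsq hB]
    exact ⟨HilbertOperator.adjoint_comp_self_isPositive_and_isTraceClass hA',
      HilbertOperator.adjoint_comp_self_isPositive_and_isTraceClass hB',
      HilbertOperator.opG_adjoint_comp_self_sub_le c hA' hB'⟩
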